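/- Let $(M,g)$ be a spacetime of dimension $d$: a smooth $d$-dimensional manifold (Hausdorff, second countable) with a smooth metric of signature $(-,+,\dots,+)$ and Levi-Civita connection $\nabla$. Let $\tau$ be a smooth null vector field, i.e. $\tau$ vanishes nowhere and $\tau_k\tau^k=0$ everywhere. Call $\tau$ a Killing vector if $\nabla_i\tau_j+\nabla_j\tau_i=0$; hypersurface orthogonal if near every point there are smooth functions $\lambda,f$ with $\tau_i=\lambda\nabla_i f$; and doubly torqued with scalar field $\kappa$ and covector fields $\alpha_i,\beta_i$ if $$\nabla_j\tau_k=\kappa\, g_{jk}+\alpha_j\tau_k+\tau_j\beta_k,\qquad \alpha_k\tau^k=0,\quad \beta_k\tau^k=0 .$$ (1) If $\tau$ is a hypersurface orthogonal Killing vector, then it is doubly torqued with $\kappa=0$ and $\alpha_i=-\beta_i$: there is a smooth covector field $\alpha_i$ on $M$ with $\nabla_i\tau_j=\alpha_i\tau_j-\tau_i\alpha_j$ and $\alpha_k\tau^k=0$. (2) Conversely, if $\tau$ is doubly torqued with some $\kappa$ and with $\beta_i=-\alpha_i$ (in particular, if $\nabla_i\tau_j=\alpha_i\tau_j-\tau_i\alpha_j$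 with $\alpha_k\tau^k=0$), then $\tau$ is a Killing vector. -/

import Mathlib

open Bundle
open scoped Manifold ContDiff Topology

noncomputable section

namespace Spacetime

universe u v w

section General

variable {E : Type u} [NormedAddCommGroup E] [NormedSpace ℝ E]
  {H : Type v} [TopologicalSpace H] {I : ModelWithCorners ℝ E H}
  {M : Type w} [TopologicalSpace M] [ChartedSpace H M] [IsManifold I ∞ M]

variable (I M) in
/-- A smooth Lorentzian metric, of signature `(-,+,…,+)`: a smooth field of symmetric bilinear
forms on the tangent spaces, such that every tangent space has a vector `u` of negative square on
whose orthogonal complement the form is positive definite. -/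
structure LorentzianMetric where
  inner (x : M) : TangentSpace I x →L[ℝ] TangentSpace I x →L[ℝ] ℝ
  symm (x : M) (v w : TangentSpace I x) : inner x v w = inner x w v
  signature (x : M) : ∃ u : TangentSpace I x, inner x u u < 0 ∧
    ∀ v : TangentSpace I x, inner x u v = 0 → v ≠ 0 → 0 < inner x v v
  contMDiff : ContMDiff I (I.prod 𝓘(ℝ, E →L[ℝ] E →L[ℝ] ℝ)) ∞
    (fun x ↦ TotalSpace.mk' (E →L[ℝ] E →L[ℝ] ℝ) x (inner x))

namespace LorentzianMetric

variable (g : LorentzianMetric I M)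

theorem nondegenerate (x : M) (v : TangentSpace I x) (hv : ∀ w, g.inner x v w = 0) : v = 0 := by
  by_contra h
  obtain ⟨u, _, hu'⟩ := g.signature x
  have := hu' v (by rw [g.symm]; exact hv u) h
  rw [hv v] at this
  exact lt_irrefl _ this

/-- On a finite-dimensional manifold, the musical map `v ↦ g(v, ·)` is invertible. -/
theorem isInvertible [FiniteDimensional ℝ E] (x : M) : (g.inner x).IsInvertible := by
  have : FiniteDimensional ℝ (TangentSpace I x) := inferInstanceAs (FiniteDimensional ℝ E)
  have : T2Space (TangentSpace I x) := inferInstanceAs (T2Space E)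
  have : T2Space (TangentSpace I x →L[ℝ] ℝ) := inferInstanceAs (T2Space (E →L[ℝ] ℝ))
  have : FiniteDimensional ℝ (TangentSpace I x →L[ℝ] ℝ) :=
    inferInstanceAs (FiniteDimensional ℝ (E →L[ℝ] ℝ))
  have hinj : Function.Injective (g.inner x).toLinearMap := by
    rw [injective_iff_map_eq_zero]
    intro v hv
    exact g.nondegenerate x v fun w ↦ congrArg (fun φ : TangentSpace I x →L[ℝ] ℝ ↦ φ w) hv
  have hdim : Module.finrank ℝ (TangentSpace I x)
      = Module.finrank ℝ (TangentSpace I x →L[ℝ] ℝ) := by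
    rw [← (LinearMap.toContinuousLinearMap (𝕜 := ℝ) (E := TangentSpace I x) (F' := ℝ)).finrank_eq]
    exact (Subspace.dual_finrank_eq (K := ℝ) (V := TangentSpace I x)).symm
  refine ⟨(LinearMap.linearEquivOfInjective _ hinj hdim).toContinuousLinearEquiv, ?_⟩
  ext v w
  rfl

theorem inner_inverse [FiniteDimensional ℝ E] (x : M) (φ : TangentSpace I x →L[ℝ] ℝ) :
    g.inner x ((g.inner x).inverse φ) = φ := by
  obtain ⟨e, he⟩ := g.isInvertible x
  rw [← he, ContinuousLinearMap.inverse_equiv]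
  exact e.apply_symm_apply φ

theorem mdifferentiableAt_inner {X Y : Π x : M, TangentSpace I x} {x : M}
    (hX : MDiffAt (T% X) x) (hY : MDiffAt (T% Y) x) :
    MDiffAt (fun y ↦ g.inner y (X y) (Y y)) x := by
  have : MDifferentiableAt I (I.prod 𝓘(ℝ))
      (fun m ↦ TotalSpace.mk' ℝ (E := Bundle.Trivial M ℝ) m (g.inner m (X m) (Y m))) x := by
    apply MDifferentiableAt.clm_bundle_apply₂ (F₁ := E) (F₂ := E)
    · exact g.contMDiff.contMDiffAt.mdifferentiableAt (by simp)
    · exact hX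
    · exact hY
  rw [mdifferentiableAt_totalSpace] at this
  exact this.2

/-- The Koszul expression: the right-hand side of the Koszul formula
`2 g(∇_X Y, Z) = X g(Y, Z) + Y g(X, Z) - Z g(X, Y) + g([X, Y], Z) - g([X, Z], Y) - g([Y, Z], X)`. -/
def koszul (X Y Z : Π x : M, TangentSpace I x) (x : M) : ℝ :=
  d% (fun y ↦ g.inner y (Y y) (Z y)) x (X x)
    + d% (fun y ↦ g.inner y (X y) (Z y)) x (Y x)
    - d% (fun y ↦ g.inner y (X y) (Y y)) x (Z x)
    + g.inner x (VectorField.mlieBracket I X Y x) (Z x)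
    - g.inner x (VectorField.mlieBracket I X Z x) (Y x)
    - g.inner x (VectorField.mlieBracket I Y Z x) (X x)

variable {X X' Y Y' Z Z' : Π x : M, TangentSpace I x} {f : M → ℝ} {x : M}

theorem d_inner_smul_left (hf : MDiffAt f x) (hX : MDiffAt (T% X) x) (hY : MDiffAt (T% Y) x)
    (v : TangentSpace I x) :
    d% (fun y ↦ g.inner y ((f • X) y) (Y y)) x v
      = f x * d% (fun y ↦ g.inner y (X y) (Y y)) x v + d% f x v * g.inner x (X x) (Y x) := by
  have : (fun y ↦ g.inner y ((f • X) y) (Y y)) = fun y ↦ f y * g.inner y (X y) (Y y) := by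
    ext y; simp
  rw [this, mvfderiv_fun_mul hf (g.mdifferentiableAt_inner hX hY)]
  simp
  ring

theorem d_inner_smul_right (hf : MDiffAt f x) (hX : MDiffAt (T% X) x) (hY : MDiffAt (T% Y) x)
    (v : TangentSpace I x) :
    d% (fun y ↦ g.inner y (X y) ((f • Y) y)) x v
      = f x * d% (fun y ↦ g.inner y (X y) (Y y)) x v + d% f x v * g.inner x (X x) (Y x) := by
  have : (fun y ↦ g.inner y (X y) ((f • Y) y)) = fun y ↦ f y * g.inner y (X y) (Y y) := by
    ext y; simp
  rw [this, mvfderiv_fun_mul hf (g.mdifferentiableAt_inner hX hY)]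
  simp
  ring

theorem d_inner_add_left (hX : MDiffAt (T% X) x) (hX' : MDiffAt (T% X') x)
    (hY : MDiffAt (T% Y) x) (v : TangentSpace I x) :
    d% (fun y ↦ g.inner y ((X + X') y) (Y y)) x v
      = d% (fun y ↦ g.inner y (X y) (Y y)) x v + d% (fun y ↦ g.inner y (X' y) (Y y)) x v := by
  have : (fun y ↦ g.inner y ((X + X') y) (Y y))
      = fun y ↦ g.inner y (X y) (Y y) + g.inner y (X' y) (Y y) := by
    ext y; simp
  rw [this, mvfderiv_fun_add (g.mdifferentiableAt_inner hX hY) (g.mdifferentiableAt_inner hX' hY)]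
  simp

theorem d_inner_add_right (hX : MDiffAt (T% X) x) (hY : MDiffAt (T% Y) x)
    (hY' : MDiffAt (T% Y') x) (v : TangentSpace I x) :
    d% (fun y ↦ g.inner y (X y) ((Y + Y') y)) x v
      = d% (fun y ↦ g.inner y (X y) (Y y)) x v + d% (fun y ↦ g.inner y (X y) (Y' y)) x v := by
  have : (fun y ↦ g.inner y (X y) ((Y + Y') y))
      = fun y ↦ g.inner y (X y) (Y y) + g.inner y (X y) (Y' y) := by
    ext y; simp
  rw [this, mvfderiv_fun_add (g.mdifferentiableAt_inner hX hY) (g.mdifferentiableAt_inner hX hY')]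
  simp

theorem ext_inner {A B : TangentSpace I x →L[ℝ] TangentSpace I x}
    (h : ∀ X Z : Π x : M, TangentSpace I x, MDiffAt (T% X) x → MDiffAt (T% Z) x →
      g.inner x (A (X x)) (Z x) = g.inner x (B (X x)) (Z x)) : A = B := by
  ext v
  rw [← sub_eq_zero]
  refine g.nondegenerate x _ fun w ↦ ?_
  have := h (FiberBundle.extend E v) (FiberBundle.extend E w)
    (FiberBundle.mdifferentiableAt_extend ..) (FiberBundle.mdifferentiableAt_extend ..)
  simpa [sub_eq_zero] using this

variable [CompleteSpace E]

theorem koszul_tensorial_left (hY : MDiffAt (T% Y) x) (hZ : MDiffAt (T% Z) x) :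
    TensorialAt I E (fun X ↦ g.koszul X Y Z x) x where
  smul hf hX := by
    simp only [koszul, g.d_inner_smul_left hf hX hZ, g.d_inner_smul_left hf hX hY,
      VectorField.mlieBracket_smul_left hf hX]
    simp
    ring
  add hX hX' := by
    simp only [koszul, g.d_inner_add_left hX hX' hZ, g.d_inner_add_left hX hX' hY,
      VectorField.mlieBracket_add_left hX hX']
    simp
    ring

theorem koszul_tensorial_right (hX : MDiffAt (T% X) x) (hY : MDiffAt (T% Y) x) :
    TensorialAt I E (fun Z ↦ g.koszul X Y Z x) x where
  smul hf hZ := by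
    simp only [koszul, g.d_inner_smul_right hf hX hZ, g.d_inner_smul_right hf hY hZ,
      VectorField.mlieBracket_smul_right hf hZ]
    simp [g.symm x _ (Y x), g.symm x _ (X x)]
    ring
  add hZ hZ' := by
    simp only [koszul, g.d_inner_add_right hX hZ hZ', g.d_inner_add_right hY hZ hZ',
      VectorField.mlieBracket_add_right hZ hZ']
    simp
    ring

theorem koszul_smul_middle (hf : MDiffAt f x) (hX : MDiffAt (T% X) x) (hY : MDiffAt (T% Y) x)
    (hZ : MDiffAt (T% Z) x) :
    g.koszul X (f • Y) Z x
      = f x * g.koszul X Y Z x + 2 * (d% f x (X x) * g.inner x (Y x) (Z x)) := by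
  simp only [koszul, g.d_inner_smul_left hf hY hZ, g.d_inner_smul_right hf hX hY,
    VectorField.mlieBracket_smul_left hf hY, VectorField.mlieBracket_smul_right hf hY]
  simp [g.symm x (Y x) (X x)]
  ring

theorem koszul_add_middle (hX : MDiffAt (T% X) x) (hY : MDiffAt (T% Y) x)
    (hY' : MDiffAt (T% Y') x) (hZ : MDiffAt (T% Z) x) :
    g.koszul X (Y + Y') Z x = g.koszul X Y Z x + g.koszul X Y' Z x := by
  simp only [koszul, g.d_inner_add_left hY hY' hZ, g.d_inner_add_right hX hY hY',
    VectorField.mlieBracket_add_left hY hY', VectorField.mlieBracket_add_right hY hY']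
  simp
  ring

variable [FiniteDimensional ℝ E]

/-- The bilinear form `(v, w) ↦ 2 g(∇_v Y, w)` on the tangent space at `x`, given by the Koszul
formula, for a vector field `Y` that is differentiable at `x`. -/
def koszulForm (Y : Π x : M, TangentSpace I x) (x : M) (hY : MDiffAt (T% Y) x) :
    TangentSpace I x →L[ℝ] TangentSpace I x →L[ℝ] ℝ :=
  TensorialAt.mkHom₂ (fun X Z ↦ g.koszul X Y Z x) x
    (fun _ hZ ↦ g.koszul_tensorial_left hY hZ) (fun _ hX ↦ g.koszul_tensorial_right hX hY)

theorem koszulForm_apply (hX : MDiffAt (T% X) x) (hY : MDiffAt (T% Y) x)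
    (hZ : MDiffAt (T% Z) x) :
    g.koszulForm Y x hY (X x) (Z x) = g.koszul X Y Z x :=
  TensorialAt.mkHom₂_apply (Φ := fun X Z ↦ g.koszul X Y Z x) _ _ hX hZ

open Classical in
/-- The operator underlying the Levi-Civita connection: `∇ Y` at `x` is the endomorphism of the
tangent space whose lowered form is half the Koszul form (and `0` where `Y` is not
differentiable). -/
def leviCivitaFun (Y : Π x : M, TangentSpace I x) (x : M) :
    TangentSpace I x →L[ℝ] TangentSpace I x :=
  if hY : MDiffAt (T% Y) x then (g.inner x).inverse ∘L ((1 / 2 : ℝ) • g.koszulForm Y x hY) else 0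

theorem inner_leviCivitaFun (hX : MDiffAt (T% X) x) (hY : MDiffAt (T% Y) x)
    (hZ : MDiffAt (T% Z) x) :
    g.inner x (g.leviCivitaFun Y x (X x)) (Z x) = 1 / 2 * g.koszul X Y Z x := by
  rw [leviCivitaFun, dif_pos hY, ContinuousLinearMap.comp_apply, inner_inverse]
  simp [g.koszulForm_apply hX hY hZ]

/-- The Levi-Civita connection of a Lorentzian metric, as a covariant derivative on the tangent
bundle: `g.leviCivita Y x v` is `(∇_v Y)(x)`. -/
def leviCivita : CovariantDerivative I E (TangentSpace I : M → Type u) where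
  toFun := g.leviCivitaFun
  isCovariantDerivativeOnUniv :=
    { add := by
        intro Y Y' x hY hY' _
        refine g.ext_inner fun X Z hX hZ ↦ ?_
        have hadd : MDiffAt (T% (Y + Y')) x := mdifferentiableAt_add_section hY hY'
        rw [g.inner_leviCivitaFun hX hadd hZ, g.koszul_add_middle hX hY hY' hZ]
        simp only [add_apply, map_add]
        rw [g.inner_leviCivitaFun hX hY hZ, g.inner_leviCivitaFun hX hY' hZ]
        ring
      leibniz := by
        intro Y f x hY hf _
        refine g.ext_inner fun X Z hX hZ ↦ ?_
        have hsmul : MDiffAt (T% (f • Y)) x := hf.smul_section hY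
        rw [g.inner_leviCivitaFun hX hsmul hZ, g.koszul_smul_middle hf hX hY hZ]
        simp only [add_apply, map_add, smul_apply, map_smul,
          ContinuousLinearMap.smulRight_apply, smul_eq_mul]
        rw [g.inner_leviCivitaFun hX hY hZ]
        ring }

/-- The Levi-Civita connection is torsion-free. -/
theorem leviCivita_torsionFree (hX : MDiffAt (T% X) x) (hY : MDiffAt (T% Y) x) :
    g.leviCivita Y x (X x) - g.leviCivita X x (Y x) = VectorField.mlieBracket I X Y x := by
  rw [← sub_eq_zero]
  refine g.nondegenerate x _ fun w ↦ ?_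
  have hZ := FiberBundle.mdifferentiableAt_extend I E w
  have h1 := g.inner_leviCivitaFun hX hY hZ
  have h2 := g.inner_leviCivitaFun hY hX hZ
  simp only [FiberBundle.extend_apply_self] at h1 h2
  simp only [leviCivita, map_sub, sub_apply, h1, h2, koszul, FiberBundle.extend_apply_self]
  rw [VectorField.mlieBracket_swap_apply (V := Y) (W := X)]
  simp only [g.symm _ (Y _) (X _), map_neg, neg_apply]
  ring

/-- The Levi-Civita connection is compatible with the metric. -/
theorem leviCivita_metric (hX : MDiffAt (T% X) x) (hY : MDiffAt (T% Y) x)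
    (hZ : MDiffAt (T% Z) x) :
    d% (fun y ↦ g.inner y (Y y) (Z y)) x (X x)
      = g.inner x (g.leviCivita Y x (X x)) (Z x) + g.inner x (Y x) (g.leviCivita Z x (X x)) := by
  have h1 := g.inner_leviCivitaFun hX hY hZ
  have h2 := g.inner_leviCivitaFun hX hZ hY
  rw [g.symm x (Y x)]
  simp only [leviCivita, h1, h2, koszul]
  rw [VectorField.mlieBracket_swap_apply (V := Z) (W := Y)]
  simp only [g.symm _ (Z _) (Y _), map_neg, neg_apply]
  ring

/-- The components `∇_i τ_j` of the covariant derivative of `τ`, with the index of `τ` lowered: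
`g.covDeriv τ x v w = v^i w^j ∇_i τ_j = g(∇_v τ, w)`. -/
def covDeriv (τ : Π x : M, TangentSpace I x) (x : M) (v w : TangentSpace I x) : ℝ :=
  g.inner x (g.leviCivita τ x v) w

/-- A null vector field: nowhere zero, with `τ_k τ^k = 0` everywhere. -/
def IsNull (τ : Π x : M, TangentSpace I x) : Prop :=
  ∀ x, τ x ≠ 0 ∧ g.inner x (τ x) (τ x) = 0

/-- The Killing equation `∇_i τ_j + ∇_j τ_i = 0`. -/
def IsKilling (τ : Π x : M, TangentSpace I x) : Prop :=
  ∀ (x : M) (v w : TangentSpace I x), g.covDeriv τ x v w + g.covDeriv τ x w v = 0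

/-- `τ` is hypersurface orthogonal: near every point, `τ_i = λ ∇_i f` for smooth functions `λ`
and `f`. -/
def IsHypersurfaceOrthogonal (τ : Π x : M, TangentSpace I x) : Prop :=
  ∀ p : M, ∃ U : Set M, IsOpen U ∧ p ∈ U ∧ ∃ l f : M → ℝ,
    ContMDiffOn I 𝓘(ℝ) ∞ l U ∧ ContMDiffOn I 𝓘(ℝ) ∞ f U ∧
    ∀ x ∈ U, ∀ v : TangentSpace I x, g.inner x (τ x) v = l x * d% f x v

/-- `τ` is doubly torqued with data `(κ, α, β)`:
`∇_j τ_k = κ g_{jk} + α_j τ_k + τ_j β_k`, with `α_k τ^k = 0` and `β_k τ^k = 0`. -/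
structure IsDoublyTorqued (τ : Π x : M, TangentSpace I x) (κ : M → ℝ)
    (α β : Π x : M, TangentSpace I x →L[ℝ] ℝ) : Prop where
  eq (x : M) (v w : TangentSpace I x) : g.covDeriv τ x v w =
    κ x * g.inner x v w + α x v * g.inner x (τ x) w + g.inner x (τ x) v * β x w
  left_orthogonal (x : M) : α x (τ x) = 0
  right_orthogonal (x : M) : β x (τ x) = 0

end LorentzianMetric

/-- Smoothness of a covector field. -/
def IsSmoothCovector (α : Π x : M, TangentSpace I x →L[ℝ] ℝ) : Prop :=
  ContMDiff I (I.prod 𝓘(ℝ, E →L[ℝ] ℝ)) ∞ (fun x ↦ TotalSpace.mk' (E →L[ℝ] ℝ) x (α x))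

end General

end Spacetime

end

/-! Write `ω = g(τ, ·)`. Killing says that `∇ω` is antisymmetric, so `∇ω` is half the exterior
derivative of `ω`. Where `ω = l df`, that derivative is `dl ∧ df` (`covDeriv_sub_covDeriv_swap`),
`l` has no zeros because `τ` has none, and substituting `df = ω / l` gives `∇ω = α ∧ ω` with `α = dl
/ (2l)`. The local `α` are unique only up to multiples of `ω`, but the equation is affine in `α`, so
a partition of unity glues them. Nullness gives `g(∇_v τ, τ) = 0`. Contracting `∇ω` with `τ` in its
second slot then yields `α(τ) = 0` in the direct part, and `κ = 0` in the converse, where what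
remains of `∇ω` is antisymmetric. -/

open VectorField Set

/-! ### Differentials of functions and Lie brackets -/

section
variable {E : Type*} [NormedAddCommGroup E] [NormedSpace ℝ E]
  {H : Type*} [TopologicalSpace H] {I : ModelWithCorners ℝ E H}
  {M : Type*} [TopologicalSpace M] [ChartedSpace H M]

/-- The differential of a smooth function is a smooth section of the cotangent bundle. -/
theorem ContMDiffAt.mvfderiv_section [IsManifold I ∞ M] {f : M → ℝ} {x : M}
    (hf : ContMDiffAt I 𝓘(ℝ) ∞ f x) :
    ContMDiffAt I (I.prod 𝓘(ℝ, E →L[ℝ] ℝ)) ∞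
      (fun y ↦ TotalSpace.mk' (E →L[ℝ] ℝ) (E := fun y : M ↦ TangentSpace I y →L[ℝ] ℝ)
        y (d% f y)) x := by
  rw [contMDiffAt_hom_bundle]
  refine ⟨contMDiffAt_id, ?_⟩
  have h := ContMDiffAt.mfderiv_const (m := ∞) hf (by simp)
  convert h using 1
  ext y v
  simp [inTangentCoordinates, ContinuousLinearMap.inCoordinates, mvfderiv]
  rfl

variable [IsManifold I ∞ M]

/-- Chain rule: pulling `V` back applies the inverse of the derivative of the inverse chart, which
cancels against that derivative. -/
theorem mvfderiv_eq_fderivWithin_comp_extChartAt_symm {f : M → ℝ} {x : M} {y : E}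
    (hy : y ∈ (extChartAt I x).target) (hf : MDiffAt f ((extChartAt I x).symm y))
    (V : Π x : M, TangentSpace I x) :
    d% f ((extChartAt I x).symm y) (V ((extChartAt I x).symm y)) =
      fderivWithin ℝ (f ∘ (extChartAt I x).symm) (range I) y
        (mpullbackWithin 𝓘(ℝ, E) I (extChartAt I x).symm V (range I) y) := by
  have hφ : MDifferentiableWithinAt 𝓘(ℝ, E) I (extChartAt I x).symm (range I) y :=
    mdifferentiableWithinAt_extChartAt_symm hy
  have hu : UniqueMDiffWithinAt 𝓘(ℝ, E) (range I) y :=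
    I.uniqueMDiffOn _ (extChartAt_target_subset_range x hy)
  have h := mvfderiv_comp_mfderivWithin y hf hφ hu
  have h' : fderivWithin ℝ (f ∘ (extChartAt I x).symm) (range I) y =
    mvfderivWithin 𝓘(ℝ, E) (f ∘ (extChartAt I x).symm) (range I) y := by
    rw [mvfderivWithin, mfderivWithin_eq_fderivWithin]; rfl
  rw [h', h, mpullbackWithin_apply]
  obtain ⟨e, he⟩ := isInvertible_mfderivWithin_extChartAt_symm hy
  rw [← he, ContinuousLinearMap.inverse_equiv]
  exact congrArg _ (e.apply_symm_apply _).symm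

/-- Used with `A`, `B` the derivatives of the inverse chart and of the chart, to undo the two
successive pullbacks of a bracket. -/
theorem ContinuousLinearMap.IsInvertible.inverse_inverse_of_comp_eq_id {F G : Type*}
    [AddCommGroup F] [Module ℝ F] [TopologicalSpace F] [AddCommGroup G] [Module ℝ G]
    [TopologicalSpace G] {A : F →L[ℝ] G} {B : G →L[ℝ] F} (hA : A.IsInvertible)
    (h : B ∘L A = .id ℝ F) (v : F) : A.inverse (B.inverse v) = v := by
  obtain ⟨e, rfl⟩ := hA
  have hB : B = (e.symm : G →L[ℝ] F) := by
    ext w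
    simpa using congrArg (fun T : F →L[ℝ] F ↦ T (e.symm w)) h
  rw [hB, inverse_equiv, inverse_equiv]
  simp

theorem ContMDiffAt.mdifferentiableAt_mvfderiv_apply {f : M → ℝ} {V : Π x : M, TangentSpace I x}
    {x : M} (hf : ContMDiffAt I 𝓘(ℝ) ∞ f x) (hV : MDiffAt (T% V) x) :
    MDiffAt (fun y ↦ d% f y (V y)) x := by
  have : MDifferentiableAt I (I.prod 𝓘(ℝ))
      (fun m ↦ TotalSpace.mk' ℝ (E := Bundle.Trivial M ℝ) m (d% f m (V m))) x :=
    MDifferentiableAt.clm_bundle_apply (F₁ := E)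
      (hf.mvfderiv_section.mdifferentiableAt (by simp)) hV
  rw [mdifferentiableAt_totalSpace] at this
  exact this.2

/-- The differential of a smooth function along a Lie bracket is the commutator of the
derivations defined by the two vector fields. -/
theorem mvfderiv_mlieBracket [CompleteSpace E] {f : M → ℝ} {V W : Π x : M, TangentSpace I x} {x : M}
    (hf : ContMDiffAt I 𝓘(ℝ) ∞ f x) (hV : MDiffAt (T% V) x) (hW : MDiffAt (T% W) x) :
    d% f x (mlieBracket I V W x) =
      d% (fun y ↦ d% f y (W y)) x (V x) - d% (fun y ↦ d% f y (V y)) x (W x) := by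
  set φ := extChartAt I x with hφ
  have hx : φ.symm (φ x) = x := extChartAt_to_inv x
  have hxt : φ x ∈ φ.target := mem_extChartAt_target x
  have hsymm : Filter.Tendsto φ.symm (𝓝[range I] (φ x)) (𝓝 x) := by
    have := (continuousAt_extChartAt_symm (I := I) x).continuousWithinAt (s := range I)
    rw [ContinuousWithinAt, hx] at this
    exact this
  have hev : ∀ᶠ y in 𝓝[range I] (φ x), y ∈ φ.target ∧ MDiffAt f (φ.symm y) := by
    refine Filter.Eventually.and (extChartAt_target_mem_nhdsWithin x) (hsymm.eventually ?_)
    exact ((contMDiffAt_iff_contMDiffAt_nhds (n := 1) (by simp)).1 (hf.of_le (by simp))).mono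
      fun y hy ↦ hy.mdifferentiableAt (by simp)
  -- The identity must hold near `φ x`, not only at it, because it is differentiated once more.
  have key (V : Π x : M, TangentSpace I x) : (fun y ↦ d% f y (V y)) ∘ φ.symm =ᶠ[𝓝[range I] (φ x)]
      fun y ↦ fderivWithin ℝ (f ∘ φ.symm) (range I) y
        (mpullbackWithin 𝓘(ℝ, E) I φ.symm V (range I) y) :=
    hev.mono fun y hy ↦ mvfderiv_eq_fderivWithin_comp_extChartAt_symm hy.1 hy.2 V
  have comp (V W : Π x : M, TangentSpace I x) (hW : MDiffAt (T% W) x) :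
      d% (fun y ↦ d% f y (W y)) x (V x) =
        fderivWithin ℝ (fun y ↦ fderivWithin ℝ (f ∘ φ.symm) (range I) y
          (mpullbackWithin 𝓘(ℝ, E) I φ.symm W (range I) y)) (range I) (φ x)
          (mpullbackWithin 𝓘(ℝ, E) I φ.symm V (range I) (φ x)) := by
    have := mvfderiv_eq_fderivWithin_comp_extChartAt_symm (f := fun y ↦ d% f y (W y)) hxt
      (by rw [hx]; exact hf.mdifferentiableAt_mvfderiv_apply hW) V
    rw [← (key W).fderivWithin_eq ((key W).self_of_nhdsWithin (mem_range_self _)), ← this, ← hφ, hx]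
  rw [comp V W hW, comp W V hV]
  have hdiff (V : Π x : M, TangentSpace I x) (hV : MDiffAt (T% V) x) :
      DifferentiableWithinAt ℝ (mpullbackWithin 𝓘(ℝ, E) I φ.symm V (range I)) (range I) (φ x) := by
    have := (mdifferentiableWithinAt_univ.2 hV).differentiableWithinAt_mpullbackWithin_vectorField
    rwa [preimage_univ, univ_inter] at this
  have hfφ : ContDiffWithinAt ℝ ∞ (f ∘ φ.symm) (range I) (φ x) :=
    (contMDiffAt_iff.1 hf).2
  have htwo : minSmoothness ℝ 2 ≤ ∞ := by
    simpa using WithTop.coe_le_coe.2 (le_top (a := (2 : ℕ∞)))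
  -- In the chart, the second-derivative terms of the commutator cancel by symmetry; `range I` lies
  -- in the closure of its interior, so this also holds at boundary points.
  refine Eq.trans ?_ (fderivWithin_apply_lieBracket (n := ∞) hfφ htwo I.uniqueDiffOn
    (I.range_subset_closure_interior (mem_range_self _)) (mem_range_self _) (hdiff W hW)
    (hdiff V hV))
  have := mvfderiv_eq_fderivWithin_comp_extChartAt_symm (V := mlieBracket I V W) (f := f) hxt
    (by rw [hx]; exact hf.mdifferentiableAt (by simp))
  rw [← hφ, hx] at this
  rw [this]
  congr 1
  have hid := mfderiv_extChartAt_comp_mfderivWithin_extChartAt_symm hxt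
  let V' : E → E := mpullbackWithin 𝓘(ℝ, E) I φ.symm V (range I)
  let W' : E → E := mpullbackWithin 𝓘(ℝ, E) I φ.symm W (range I)
  let L : E := lieBracketWithin ℝ V' W' (range I) (φ x)
  have := (isInvertible_mfderivWithin_extChartAt_symm hxt).inverse_inverse_of_comp_eq_id hid L
  rw [mpullbackWithin_apply]
  refine Eq.trans ?_ this
  congr 1
  rw [← hφ, hx, ← mlieBracketWithin_univ, mlieBracketWithin_apply, preimage_univ, univ_inter]
end

/-! ### Null fields: Killing versus doubly torqued -/

namespace Spacetime.LorentzianMetric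

variable {E : Type*} [NormedAddCommGroup E] [NormedSpace ℝ E] [FiniteDimensional ℝ E]
  {H : Type*} [TopologicalSpace H] {I : ModelWithCorners ℝ E H}
  {M : Type*} [TopologicalSpace M] [ChartedSpace H M] [IsManifold I ∞ M]
  [CompleteSpace E] (g : LorentzianMetric I M) {τ : Π x : M, TangentSpace I x}

/-- The exterior derivative of the covector field `g(τ, ·) = l df` is `dl ∧ df`. -/
theorem covDeriv_sub_covDeriv_swap {l f : M → ℝ} {x : M} (hτ : MDiffAt (T% τ) x)
    (hl : MDiffAt l x) (hf : ContMDiffAt I 𝓘(ℝ) ∞ f x)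
    (h : ∀ᶠ y in 𝓝 x, ∀ v : TangentSpace I y, g.inner y (τ y) v = l y * d% f y v)
    (v w : TangentSpace I x) :
    g.covDeriv τ x v w - g.covDeriv τ x w v = d% l x v * d% f x w - d% l x w * d% f x v := by
  set X := FiberBundle.extend E v
  set Z := FiberBundle.extend E w
  have hX : MDiffAt (T% X) x := FiberBundle.mdifferentiableAt_extend I E v
  have hZ : MDiffAt (T% Z) x := FiberBundle.mdifferentiableAt_extend I E w
  have hXv : X x = v := FiberBundle.extend_apply_self ..
  have hZw : Z x = w := FiberBundle.extend_apply_self ..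
  have hd {Y : Π x : M, TangentSpace I x} (hY : MDiffAt (T% Y) x) (u : TangentSpace I x) :
      d% (fun y ↦ g.inner y (τ y) (Y y)) x u =
        l x * d% (fun y ↦ d% f y (Y y)) x u + d% l x u * d% f x (Y x) := by
    have he : (fun y ↦ g.inner y (τ y) (Y y)) =ᶠ[𝓝 x] fun y ↦ l y * d% f y (Y y) :=
      h.mono fun y hy ↦ hy (Y y)
    have he' : d% (fun y ↦ g.inner y (τ y) (Y y)) x = d% (fun y ↦ l y * d% f y (Y y)) x := by
      rw [mvfderiv, he.mfderiv_eq]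
      rfl
    rw [he', mvfderiv_fun_mul hl (hf.mdifferentiableAt_mvfderiv_apply hY)]
    simp
    ring
  -- Metric compatibility and zero torsion turn the left side into `X ω(Z) - Z ω(X) - ω([X, Z])`
  -- with `ω = g(τ, ·)`; the iterated derivatives of `f` then cancel against `l df([X, Z])`.
  have h1 := g.leviCivita_metric hX hτ hZ
  have h2 := g.leviCivita_metric hZ hτ hX
  have h3 := congrArg (g.inner x (τ x)) (g.leviCivita_torsionFree hX hZ)
  rw [map_sub, h.self_of_nhds (mlieBracket I X Z x), mvfderiv_mlieBracket hf hX hZ] at h3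
  rw [hd hZ] at h1
  rw [hd hX] at h2
  rw [hXv, hZw] at h1 h2 h3
  simp only [covDeriv]
  linear_combination h2 - h1 - h3

variable {g}

/-- Differentiate the constant `g(τ, τ) = 0` along `v`. -/
theorem IsNull.covDeriv_self_eq_zero (hnull : g.IsNull τ) {x : M} (hτ : MDiffAt (T% τ) x)
    (v : TangentSpace I x) : g.covDeriv τ x v (τ x) = 0 := by
  have hX : MDiffAt (T% (FiberBundle.extend E v)) x := FiberBundle.mdifferentiableAt_extend I E v
  have h := g.leviCivita_metric hX hτ hτ
  have h0 : (fun y ↦ g.inner y (τ y) (τ y)) = fun _ ↦ 0 := funext fun y ↦ (hnull y).2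
  rw [h0, mvfderiv_const, g.symm x (τ x), FiberBundle.extend_apply_self] at h
  simp only [covDeriv]
  simp only [zero_apply] at h
  linarith

omit [FiniteDimensional ℝ E] [CompleteSpace E] in
theorem IsNull.exists_inner_ne_zero (hnull : g.IsNull τ) (x : M) :
    ∃ w, g.inner x (τ x) w ≠ 0 := by
  by_contra! h
  exact (hnull x).1 (g.nondegenerate x _ h)

/-- A null vector field that is doubly torqued with `β = -α` has `κ = 0`, and is Killing. -/
theorem IsDoublyTorqued.isKilling (hnull : g.IsNull τ) (hτ : ∀ x, MDiffAt (T% τ) x) {κ : M → ℝ}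
    {α : Π x : M, TangentSpace I x →L[ℝ] ℝ} (h : g.IsDoublyTorqued τ κ α (-α)) :
    g.IsKilling τ := by
  intro x v w
  have hκ : κ x = 0 := by
    obtain ⟨u, hu⟩ := hnull.exists_inner_ne_zero x
    -- With `τ` in the second slot every term but `κ g(u, τ)` vanishes, and `g(u, τ) ≠ 0`.
    have h1 := h.eq x u (τ x)
    rw [hnull.covDeriv_self_eq_zero (hτ x), (hnull x).2, h.right_orthogonal, g.symm x u] at h1
    simpa [hu] using h1.symm
  rw [h.eq, h.eq, hκ]
  simp
  ring

/-- If a null Killing field `τ` satisfies `τ_i = l ∇_i f`, then `∇_i τ_j = α_i τ_j - τ_i α_j` with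
`α = dl / (2 l)`. -/
theorem IsKilling.covDeriv_eq (hK : g.IsKilling τ) (hnull : g.IsNull τ) {l f : M → ℝ} {x : M}
    (hτ : MDiffAt (T% τ) x) (hl : MDiffAt l x) (hf : ContMDiffAt I 𝓘(ℝ) ∞ f x)
    (h : ∀ᶠ y in 𝓝 x, ∀ v : TangentSpace I y, g.inner y (τ y) v = l y * d% f y v)
    (v w : TangentSpace I x) :
    g.covDeriv τ x v w = ((2 * l x)⁻¹ • d% l x) v * g.inner x (τ x) w
      - g.inner x (τ x) v * ((2 * l x)⁻¹ • d% l x) w := by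
  have hl0 : l x ≠ 0 := by
    intro h0
    obtain ⟨u, hu⟩ := hnull.exists_inner_ne_zero x
    exact hu (by rw [h.self_of_nhds, h0, zero_mul])
  have h1 := g.covDeriv_sub_covDeriv_swap hτ hl hf h v w
  have h2 := hK x v w
  rw [h.self_of_nhds, h.self_of_nhds]
  simp only [smul_apply, smul_eq_mul]
  field_simp
  linarith

/-- A null hypersurface orthogonal Killing field is doubly torqued with `κ = 0` and `β = -α`. -/
theorem IsKilling.exists_isDoublyTorqued [T2Space M] [SigmaCompactSpace M]
    (hK : g.IsKilling τ) (hnull : g.IsNull τ) (hτ : ∀ x, MDiffAt (T% τ) x)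
    (ho : g.IsHypersurfaceOrthogonal τ) :
    ∃ α : Π x : M, TangentSpace I x →L[ℝ] ℝ, IsSmoothCovector α ∧ g.IsDoublyTorqued τ 0 α (-α) := by
  have hloc : ∀ x₀ : M, ∃ U ∈ 𝓝 x₀, ∃ α : Π x : M, TangentSpace I x →L[ℝ] ℝ,
      ContMDiffOn I (I.prod 𝓘(ℝ, E →L[ℝ] ℝ)) ∞
        (fun x ↦ TotalSpace.mk' (E →L[ℝ] ℝ) (E := fun y : M ↦ TangentSpace I y →L[ℝ] ℝ)
          x (α x)) U ∧
      ∀ x ∈ U, α x ∈ {a : TangentSpace I x →L[ℝ] ℝ | ∀ v w, g.covDeriv τ x v w =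
        a v * g.inner x (τ x) w - g.inner x (τ x) v * a w} := by
    intro x₀
    obtain ⟨U, hU, hxU, l, f, hl, hf, h⟩ := ho x₀
    have hn {x : M} (hx : x ∈ U) := hU.mem_nhds hx
    have hl0 {x : M} (hx : x ∈ U) : l x ≠ 0 := by
      intro h0
      obtain ⟨u, hu⟩ := hnull.exists_inner_ne_zero x
      exact hu (by rw [h x hx, h0, zero_mul])
    refine ⟨U, hn hxU, fun x ↦ (2 * l x)⁻¹ • d% l x, fun x hx ↦ ?_, fun x hx v w ↦ ?_⟩
    · have hlx := hl.contMDiffAt (hn hx)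
      have hinv : ContMDiffAt I 𝓘(ℝ) ∞ (fun x ↦ (2 * l x)⁻¹) x :=
        (contMDiffAt_const.mul hlx).inv₀ (mul_ne_zero two_ne_zero (hl0 hx))
      exact (hinv.smul_section hlx.mvfderiv_section).contMDiffWithinAt
    · exact hK.covDeriv_eq hnull (hτ x) ((hl.contMDiffAt (hn hx)).mdifferentiableAt (by simp))
        (hf.contMDiffAt (hn hx)) (Filter.eventually_of_mem (hn hx) h) v w
  -- The right side is linear in `a` and the left side does not involve it, so weights with sum 1
  -- preserve the equation.
  have hconv (x : M) : Convex ℝ {a : TangentSpace I x →L[ℝ] ℝ | ∀ v w, g.covDeriv τ x v w =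
      a v * g.inner x (τ x) w - g.inner x (τ x) v * a w} := by
    intro a ha b hb s t _ _ hst v w
    simp only [add_apply, smul_apply, smul_eq_mul]
    linear_combination s * ha v w + t * hb v w - hst * g.covDeriv τ x v w
  obtain ⟨α, hα⟩ := exists_contMDiffSection_forall_mem_convex_of_local (n := ⊤) I
    (fun y : M ↦ TangentSpace I y →L[ℝ] ℝ) (F_fiber := E →L[ℝ] ℝ) _ hconv hloc
  -- Orthogonality need not be glued: at `w = τ` the equation reduces to `0 = -g(τ, u) α(τ)`.
  have hτα (x : M) : α x (τ x) = 0 := by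
    obtain ⟨u, hu⟩ := hnull.exists_inner_ne_zero x
    have h1 := hα x u (τ x)
    rw [hnull.covDeriv_self_eq_zero (hτ x), (hnull x).2] at h1
    simpa [hu] using h1
  refine ⟨α, α.contMDiff, fun x v w ↦ ?_, hτα, fun x ↦ by simp [hτα]⟩
  rw [hα x v w]
  simp
  ring

end Spacetime.LorentzianMetric

theorem mainTheorem9 (d : ℕ) (M : Type*) [TopologicalSpace M] [T2Space M]
    [SecondCountableTopology M] [ChartedSpace (EuclideanSpace ℝ (Fin d)) M]
    [IsManifold (𝓡 d) ∞ M] (g : Spacetime.LorentzianMetric (𝓡 d) M)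
    (τ : Π x : M, TangentSpace (𝓡 d) x) (hτ : ContMDiff (𝓡 d) (𝓡 d).tangent ∞ (T% τ))
    (hnull : g.IsNull τ) :
    (g.IsKilling τ → g.IsHypersurfaceOrthogonal τ →
      ∃ α : Π x : M, TangentSpace (𝓡 d) x →L[ℝ] ℝ,
        Spacetime.IsSmoothCovector α ∧ g.IsDoublyTorqued τ 0 α (-α)) ∧
    (∀ (κ : M → ℝ) (α : Π x : M, TangentSpace (𝓡 d) x →L[ℝ] ℝ),
      g.IsDoublyTorqued τ κ α (-α) → g.IsKilling τ) := by
  -- Together with second countability this gives the σ-compactness that the partition of unity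
  -- requires.
  have : LocallyCompactSpace M := ChartedSpace.locallyCompactSpace (EuclideanSpace ℝ (Fin d)) M
  have hτd (x : M) : MDifferentiableAt (𝓡 d) (𝓡 d).tangent (T% τ) x :=
    (hτ x).mdifferentiableAt (by simp)
  exact ⟨fun hK ho ↦ hK.exists_isDoublyTorqued hnull hτd ho,
    fun _ _ h ↦ h.isKilling hnull hτd⟩
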